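/- Let $X$ be a complex Banach space, let $\mathcal B(X)$ be the algebra of all bounded linear operators on $X$, and let $T\in\mathcal B(X)$. For a linear map $S$ of a complex vector space into itself, with range $R(S)$, the descent of $S$ is $d(S)=\min\{q\ge 0: R(S^q)=R(S^{q+1})\}$, with $d(S)=\infty$ if no such $q$ exists. Put $$\sigma_{desc}(T)=\{\lambda\in\mathbb C: d(\lambda I-T)=\infty\},\qquad \sigma_{desc}(T,\mathcal B(X))=\{\lambda\in\mathbb C: d(L_{T-\lambda I})=\infty\},$$ where $L_A:\mathcal B(X)\to\mathcal B(X)$, $L_A(B)=AB$, is left multiplication by $A\in\mathcal B(X)$. Let $\rho_{su}(T)=\{\lambda\in\mathbb C:\lambda I-T\text{ is surjective}\}$, and let $\rho_p(T)=\mathbb C\setminus\sigma_p(T)$ be the set of $\lambda\in\mathbb C$ that are not eigenvalues of $T$. If $G\cap\rho_p(T)\neq\emptyset$ for every connected component $G$ of $\rho_{su}(T)$, then $$\sigma_{desc}(T)=\sigma_{desc}(T,\mathcal B(X)).$$ -/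

import Mathlib

namespace DescentSpectrum

/-- The descent of a linear endomorphism: the least `q` such that the range of `T ^ q` equals the
range of `T ^ (q + 1)`, and `⊤` if there is no such `q`. -/
noncomputable def descent {M : Type*} [AddCommGroup M] [Module ℂ M] (T : Module.End ℂ M) : ℕ∞ :=
  ⨅ q ∈ {q : ℕ | LinearMap.range (T ^ q) = LinearMap.range (T ^ (q + 1))}, (q : ℕ∞)

/-- The descent of an element `a` of an algebra: the descent of the left multiplication by `a`. -/
noncomputable def elementDescent {A : Type*} [Ring A] [Algebra ℂ A] (a : A) : ℕ∞ :=
  descent (LinearMap.mulLeft ℂ a)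

/-- The descent spectrum of an element `a` of an algebra. -/
def elementDescentSpectrum {A : Type*} [Ring A] [Algebra ℂ A] (a : A) : Set ℂ :=
  {z | elementDescent (a - algebraMap ℂ A z) = ⊤}

section Operator

variable {X : Type*} [NormedAddCommGroup X] [NormedSpace ℂ X]

/-- The descent spectrum of a bounded operator, acting on the space `X`. -/
def descentSpectrum (T : X →L[ℂ] X) : Set ℂ :=
  {z | descent ((z • ContinuousLinearMap.id ℂ X - T : X →L[ℂ] X) : Module.End ℂ X) = ⊤}

/-- The surjectivity spectrum. -/
def surjectivitySpectrum (T : X →L[ℂ] X) : Set ℂ :=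
  {z | ¬ Function.Surjective (z • ContinuousLinearMap.id ℂ X - T : X →L[ℂ] X)}

/-- The surjectivity resolvent set, the complement of the surjectivity spectrum. -/
def surjectivityResolventSet (T : X →L[ℂ] X) : Set ℂ :=
  (surjectivitySpectrum T)ᶜ

/-- The point spectrum: the set of eigenvalues. -/
def pointSpectrum (T : X →L[ℂ] X) : Set ℂ :=
  {z | Module.End.HasEigenvalue (T : Module.End ℂ X) z}

end Operator

end DescentSpectrum

namespace DescentSpectrum

/-! ### Scalar perturbations of surjective operators -/

section Perturbation

variable {E : Type*} [NormedAddCommGroup E] [NormedSpace ℂ E] [CompleteSpace E]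

/-! Right division of `A ^ q` by `A ^ (q + 1)` always gives equal ranges; the converse needs the
hypothesis, which forces every surjective `z - T` to be injective
(`notMem_pointSpectrum_of_isPreconnected`). Let `A = T - z` have equal ranges at `q`. Then `A`
induces a surjection `S` on `X ⧸ ker (A ^ q)`. If `S` were not injective, `S - μ` would be
surjective with nonzero kernel for small `μ ≠ 0`. Both properties lift to `A - μ`, a contradiction.
Hence `S` is invertible, and its inverse supplies the right factor (`exists_pow_eq_pow_succ_mul`).
-/

/-- Near a surjective bounded operator `S`, preimages of vectors under the operators `S - μ` can be
chosen close to given preimages under `S`. -/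
theorem exists_preimage_sub_smul (S : E →L[ℂ] E) (hS : Function.Surjective S) :
    ∃ ε > 0, ∀ μ : ℂ, ‖μ‖ < ε → ∀ x, ∃ w, S w - μ • w = S x ∧ ‖w - x‖ ≤ ‖x‖ / 2 := by
  obtain ⟨C, hC, hg⟩ := S.exists_preimage_norm_le hS
  choose g hgS hgn using hg
  -- Ratio `1 / 3` makes the tail of the series at most `‖x‖ / 2`, so `w ≠ 0` whenever `x ≠ 0`.
  refine ⟨1 / (3 * C), by positivity, fun μ hμ x => ?_⟩
  have hr : ‖μ‖ * C ≤ 1 / 3 := by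
    rw [lt_div_iff₀ (by positivity)] at hμ
    linarith
  -- Neumann series for the preimage; the section `g` of `S` need not be linear.
  let u : ℕ → E := fun n => μ ^ n • g^[n] x
  have hu : ∀ n, ‖u n‖ ≤ ‖x‖ * (1 / 3) ^ n := by
    intro n
    induction n with
    | zero => simp [u]
    | succ n ih =>
      calc ‖u (n + 1)‖ = ‖μ‖ ^ (n + 1) * ‖g (g^[n] x)‖ := by
            simp only [u, norm_smul, norm_pow, Function.iterate_succ_apply']
        _ ≤ ‖μ‖ ^ (n + 1) * (C * ‖g^[n] x‖) := by gcongr; exact hgn _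
        _ = ‖μ‖ * C * ‖u n‖ := by simp only [u, norm_smul, norm_pow]; ring
        _ ≤ 1 / 3 * (‖x‖ * (1 / 3) ^ n) := by gcongr
        _ = ‖x‖ * (1 / 3) ^ (n + 1) := by ring
  have hgeo : HasSum (fun n : ℕ => ‖x‖ * (1 / 3 : ℝ) ^ n) (‖x‖ * (1 - 1 / 3)⁻¹) :=
    (hasSum_geometric_of_lt_one (by norm_num) (by norm_num)).mul_left _
  have hsum : Summable u := hgeo.summable.of_norm_bounded hu
  have hsplit : ∑' n, u n = x + ∑' n, u (n + 1) := by
    rw [hsum.tsum_eq_zero_add]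
    simp [u]
  refine ⟨∑' n, u n, ?_, ?_⟩
  · have hshift : ∀ n, S (u (n + 1)) = μ • u n := fun n => by
      simp only [u, map_smul, Function.iterate_succ_apply', hgS, smul_smul, pow_succ']
    have hS' : S (∑' n, u (n + 1)) = μ • ∑' n, u n := by
      rw [S.map_tsum ((summable_nat_add_iff 1).2 hsum), ← hsum.tsum_const_smul]
      exact tsum_congr hshift
    nth_rewrite 1 [hsplit]
    rw [map_add, hS', add_sub_cancel_right]
  · rw [hsplit, add_sub_cancel_left]
    refine tsum_of_norm_bounded (g := fun n => ‖x‖ / 3 * (1 / 3 : ℝ) ^ n) ?_ fun n => ?_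
    · have h := (hasSum_geometric_of_lt_one (r := (1 / 3 : ℝ)) (by norm_num)
        (by norm_num)).mul_left (‖x‖ / 3)
      rwa [show ‖x‖ / 3 * (1 - 1 / 3 : ℝ)⁻¹ = ‖x‖ / 2 by norm_num; ring] at h
    · exact (hu (n + 1)).trans_eq (by ring)

theorem exists_forall_surjective_sub_smul (S : E →L[ℂ] E) (hS : Function.Surjective S) :
    ∃ ε > 0, ∀ μ : ℂ, ‖μ‖ < ε → Function.Surjective fun x => S x - μ • x := by
  obtain ⟨ε, hε, h⟩ := exists_preimage_sub_smul S hS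
  refine ⟨ε, hε, fun μ hμ y => ?_⟩
  obtain ⟨x, rfl⟩ := hS y
  obtain ⟨w, hw, -⟩ := h μ hμ x
  exact ⟨w, hw⟩

/-- If a surjective operator has nontrivial kernel, so do all its small scalar perturbations. -/
theorem exists_forall_ne_zero_of_apply_eq_zero (S : E →L[ℂ] E) (hS : Function.Surjective S)
    {x : E} (hx : x ≠ 0) (hSx : S x = 0) :
    ∃ ε > 0, ∀ μ : ℂ, ‖μ‖ < ε → ∃ w ≠ 0, S w = μ • w := by
  obtain ⟨ε, hε, h⟩ := exists_preimage_sub_smul S hS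
  refine ⟨ε, hε, fun μ hμ => ?_⟩
  obtain ⟨w, hw, hwx⟩ := h μ hμ x
  refine ⟨w, ?_, sub_eq_zero.1 (hw.trans hSx)⟩
  rintro rfl
  have := norm_pos_iff.2 hx
  rw [zero_sub, norm_neg] at hwx
  linarith

end Perturbation

/-! ### Eigenvalues in the surjectivity resolvent set -/

section Resolvent

variable {X : Type*} [NormedAddCommGroup X] [NormedSpace ℂ X]

theorem mem_surjectivityResolventSet {T : X →L[ℂ] X} {z : ℂ} :
    z ∈ surjectivityResolventSet T ↔
      Function.Surjective (z • ContinuousLinearMap.id ℂ X - T : X →L[ℂ] X) := by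
  simp [surjectivityResolventSet, surjectivitySpectrum]

theorem mem_pointSpectrum {T : X →L[ℂ] X} {z : ℂ} :
    z ∈ pointSpectrum T ↔ ∃ x ≠ 0, T x = z • x := by
  constructor
  · intro h
    obtain ⟨x, hx⟩ := Module.End.HasEigenvalue.exists_hasEigenvector h
    exact ⟨x, hx.2, hx.apply_eq_smul⟩
  · rintro ⟨x, hx, hTx⟩
    exact Module.End.hasEigenvalue_of_hasEigenvector
      (Module.End.hasEigenvector_iff.2 ⟨Module.End.mem_eigenspace_iff.2 hTx, hx⟩)

theorem isUnit_of_mem_surjectivityResolventSet [CompleteSpace X] {T : X →L[ℂ] X} {z : ℂ}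
    (hz : z ∈ surjectivityResolventSet T) (hz' : z ∉ pointSpectrum T) :
    IsUnit (algebraMap ℂ (X →L[ℂ] X) z - T) := by
  rw [ContinuousLinearMap.isUnit_iff_bijective]
  refine ⟨(injective_iff_map_eq_zero _).2 fun x hx => ?_, mem_surjectivityResolventSet.1 hz⟩
  by_contra hx0
  exact hz' (mem_pointSpectrum.2 ⟨x, hx0, (sub_eq_zero.1 hx).symm⟩)

theorem isOpen_surjectivityResolventSet_inter_pointSpectrum [CompleteSpace X] (T : X →L[ℂ] X) :
    IsOpen (surjectivityResolventSet T ∩ pointSpectrum T) := by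
  rw [Metric.isOpen_iff]
  rintro z ⟨hz, hz'⟩
  rw [mem_surjectivityResolventSet] at hz
  obtain ⟨x, hx, hTx⟩ := mem_pointSpectrum.1 hz'
  obtain ⟨ε₁, hε₁, h₁⟩ := exists_forall_surjective_sub_smul _ hz
  obtain ⟨ε₂, hε₂, h₂⟩ := exists_forall_ne_zero_of_apply_eq_zero _ hz hx (by simp [hTx])
  refine ⟨min ε₁ ε₂, lt_min hε₁ hε₂, fun μ hμ => ?_⟩
  rw [Metric.mem_ball', dist_eq_norm, lt_min_iff] at hμ
  constructor
  · rw [mem_surjectivityResolventSet]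
    intro y
    obtain ⟨w, hw⟩ := h₁ (z - μ) hμ.1 y
    refine ⟨w, hw ▸ ?_⟩
    simp only [sub_smul, sub_apply, smul_apply,
      ContinuousLinearMap.id_apply]
    abel
  · obtain ⟨w, hw, hTw⟩ := h₂ (z - μ) hμ.2
    refine mem_pointSpectrum.2 ⟨w, hw, ?_⟩
    simp only [sub_smul, sub_apply, smul_apply,
      ContinuousLinearMap.id_apply] at hTw
    exact sub_right_injective hTw

/-- A connected subset of the surjectivity resolvent set that contains a point which is not an
eigenvalue contains no eigenvalue. -/
theorem notMem_pointSpectrum_of_isPreconnected [CompleteSpace X] {T : X →L[ℂ] X} {G : Set ℂ}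
    (hG : IsPreconnected G) (hGT : G ⊆ surjectivityResolventSet T)
    (hne : (G ∩ (pointSpectrum T)ᶜ).Nonempty) {z : ℂ} (hz : z ∈ G) : z ∉ pointSpectrum T := by
  intro hz'
  -- Two disjoint open sets cover `G`, so `G` cannot meet both.
  have hcover : G ⊆ surjectivityResolventSet T ∩ pointSpectrum T ∪ resolventSet ℂ T := by
    intro w hw
    by_cases hw' : w ∈ pointSpectrum T
    · exact Or.inl ⟨hGT hw, hw'⟩
    · exact Or.inr (isUnit_of_mem_surjectivityResolventSet (hGT hw) hw')
  obtain ⟨w, hw, hwG⟩ := hne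
  obtain ⟨v, -, ⟨-, hv⟩, hv'⟩ := hG _ _ (isOpen_surjectivityResolventSet_inter_pointSpectrum T)
    (spectrum.isOpen_resolventSet T) hcover ⟨z, hz, hGT hz, hz'⟩
    ⟨w, hw, isUnit_of_mem_surjectivityResolventSet (hGT hw) hwG⟩
  obtain ⟨x, hx, hTx⟩ := mem_pointSpectrum.1 hv
  have hinj := (ContinuousLinearMap.isUnit_iff_bijective.1 (spectrum.mem_resolventSet_iff.1 hv')).1
  exact hx (hinj (by simp [hTx, Algebra.algebraMap_eq_smul_one]))

end Resolvent

/-! ### Descent as divisibility of powers -/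

section Descent

theorem descent_eq_top_iff {M : Type*} [AddCommGroup M] [Module ℂ M] (S : Module.End ℂ M) :
    descent S = ⊤ ↔ ∀ q : ℕ, LinearMap.range (S ^ q) ≠ LinearMap.range (S ^ (q + 1)) := by
  simp [descent, iInf_eq_top]

theorem range_pow_neg {M : Type*} [AddCommGroup M] [Module ℂ M] (S : Module.End ℂ M) (q : ℕ) :
    LinearMap.range ((-S) ^ q) = LinearMap.range (S ^ q) := by
  rcases Nat.even_or_odd q with h | h
  · rw [h.neg_pow]
  · rw [h.neg_pow, LinearMap.range_neg]

theorem descent_neg {M : Type*} [AddCommGroup M] [Module ℂ M] (S : Module.End ℂ M) :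
    descent (-S) = descent S := by
  simp only [descent, range_pow_neg]

/-- The ranges of consecutive powers of left multiplication by `a` agree exactly when `a ^ q` is
right divisible by `a ^ (q + 1)`. -/
theorem range_mulLeft_pow_eq_iff {A : Type*} [Ring A] [Algebra ℂ A] (a : A) (q : ℕ) :
    LinearMap.range (LinearMap.mulLeft ℂ a ^ q) = LinearMap.range (LinearMap.mulLeft ℂ a ^ (q + 1))
      ↔ ∃ b, a ^ q = a ^ (q + 1) * b := by
  rw [LinearMap.pow_mulLeft, LinearMap.pow_mulLeft]
  constructor
  · intro h
    have : a ^ q ∈ LinearMap.range (LinearMap.mulLeft ℂ (a ^ q)) := ⟨1, by simp⟩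
    rw [h] at this
    obtain ⟨b, hb⟩ := this
    exact ⟨b, hb.symm⟩
  · rintro ⟨b, hb⟩
    apply le_antisymm
    · rintro _ ⟨c, rfl⟩
      exact ⟨b * c, by simp [← mul_assoc, ← hb]⟩
    · rintro _ ⟨c, rfl⟩
      exact ⟨a * c, by simp [pow_succ]⟩

end Descent

/-! ### Factoring through the quotient by `ker (A ^ q)` -/

section Factorization

variable {X : Type*} [NormedAddCommGroup X] [NormedSpace ℂ X]

/-- `A` is nilpotent on `ker (A ^ q)`, so `A - μ` is onto there; surjectivity modulo this kernel
therefore lifts. -/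
theorem surjective_sub_smul_of_ker_pow (A : X →L[ℂ] X) (q : ℕ) {μ : ℂ} (hμ : μ ≠ 0)
    (h : ∀ y, ∃ x, (A ^ q) (y - (A x - μ • x)) = 0) :
    Function.Surjective fun x => A x - μ • x := by
  have key : ∀ n : ℕ, ∀ y, (A ^ n) y = 0 → ∃ x, A x - μ • x = y := by
    intro n
    induction n with
    | zero => exact fun y hy => ⟨0, by simpa using hy.symm⟩
    | succ n ih =>
      intro y hy
      obtain ⟨x, hx⟩ := ih (A y) (by rwa [pow_succ] at hy)
      -- As `(A - μ) x = A y`, applying `A - μ` to `x - y` gives `μ • y`.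
      refine ⟨μ⁻¹ • (x - y), ?_⟩
      rw [map_smul, smul_comm μ, ← smul_sub, map_sub, smul_sub μ,
        show A x - A y - (μ • x - μ • y) = A x - μ • x - (A y - μ • y) by abel, hx,
        sub_sub_cancel, inv_smul_smul₀ hμ]
  intro y
  obtain ⟨x, hx⟩ := h y
  obtain ⟨v, hv⟩ := key q _ hx
  refine ⟨x + v, ?_⟩
  simp only [map_add, smul_add]
  rw [add_sub_add_comm, hv]
  abel

/-- If the ranges of `A ^ q` and `A ^ (q + 1)` agree and all surjective operators `A - μ` with small
`μ ≠ 0` are injective, then `A ^ q` factors through `A ^ (q + 1)` on the right. -/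
theorem exists_pow_eq_pow_succ_mul [CompleteSpace X] (A : X →L[ℂ] X)
    (hA : ∀ μ : ℂ, (Function.Surjective fun x => A x - μ • x) → ∀ x, A x = μ • x → x = 0)
    (q : ℕ) (hq : ∀ x, ∃ w, (A ^ q) x = (A ^ (q + 1)) w) :
    ∃ B : X →L[ℂ] X, A ^ q = A ^ (q + 1) * B := by
  let N : Submodule ℂ X := (A ^ q).ker
  have : IsClosed (N : Set X) := (A ^ q).isClosed_ker
  have hmem : ∀ x, x ∈ N ↔ (A ^ q) x = 0 := fun x => LinearMap.mem_ker
  have hcomm : ∀ x, (A ^ q) (A x) = A ((A ^ q) x) := fun x => by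
    rw [← mul_apply_eq_comp, ← mul_apply_eq_comp, ← pow_succ, ← pow_succ']
  let π : X →L[ℂ] X ⧸ N := N.mkQL
  have hπ : Function.Surjective π := N.mkQ_surjective
  have hπ0 : ∀ x, π x = 0 ↔ (A ^ q) x = 0 := fun x =>
    (Submodule.Quotient.mk_eq_zero N).trans (hmem x)
  let S : X ⧸ N →L[ℂ] X ⧸ N := N.liftQL (π.comp A) fun x hx =>
    (hπ0 (A x)).2 (by rw [hcomm, (hmem x).1 hx, map_zero])
  have hSπ : ∀ x, S (π x) = π (A x) := fun x => rfl
  let j : X ⧸ N →L[ℂ] X := N.liftQL (A ^ q) le_rfl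
  have hjπ : ∀ x, j (π x) = (A ^ q) x := fun x => rfl
  have hAj : ∀ z, A (j z) = j (S z) := by
    intro z
    obtain ⟨x, rfl⟩ := hπ z
    rw [hSπ, hjπ, hjπ, hcomm]
  have hsurj : Function.Surjective S := by
    intro z
    obtain ⟨x, rfl⟩ := hπ z
    obtain ⟨w, hw⟩ := hq x
    refine ⟨π w, ?_⟩
    rw [hSπ, ← sub_eq_zero, ← map_sub, hπ0, map_sub, hw, pow_succ]
    simp
  have hinj : Function.Injective S := by
    refine (injective_iff_map_eq_zero S).2 fun z hz => ?_
    by_contra hz0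
    obtain ⟨ε₁, hε₁, h₁⟩ := exists_forall_surjective_sub_smul S hsurj
    obtain ⟨ε₂, hε₂, h₂⟩ := exists_forall_ne_zero_of_apply_eq_zero S hsurj hz0 hz
    obtain ⟨μ, hμ0, hμ⟩ := NormedField.exists_norm_lt ℂ (lt_min hε₁ hε₂)
    rw [lt_min_iff] at hμ
    have hsurjA := surjective_sub_smul_of_ker_pow A q (norm_pos_iff.1 hμ0) fun y => by
      obtain ⟨v, hv⟩ := h₁ μ hμ.1 (π y)
      obtain ⟨x, rfl⟩ := hπ v
      refine ⟨x, (hπ0 _).1 ?_⟩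
      rw [map_sub, map_sub, map_smul, ← hSπ, ← hv, sub_self]
    obtain ⟨w, hw, hSw⟩ := h₂ μ hμ.2
    obtain ⟨x, rfl⟩ := hπ w
    -- The injective map `j` intertwines `S` and `A`, so it carries the eigenvector `π x` to the
    -- eigenvector `A ^ q x`.
    refine hw ((hπ0 x).2 (hA μ hsurjA _ ?_))
    rw [← hjπ, hAj, hSw, map_smul]
  obtain ⟨R, hSR, -⟩ := isUnit_iff_exists.1
    (ContinuousLinearMap.isUnit_iff_bijective.2 ⟨hinj, hsurj⟩)
  have hAjR : ∀ n : ℕ, ∀ z, (A ^ n) (j ((R ^ n) z)) = j z := by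
    intro n
    induction n with
    | zero => simp
    | succ n ih =>
      intro z
      rw [pow_succ, pow_succ', mul_apply_eq_comp, mul_apply_eq_comp, hAj,
        ← mul_apply_eq_comp S R, hSR, one_apply_eq_self, ih]
  exact ⟨(j.comp (R ^ (q + 1))).comp π, ContinuousLinearMap.ext fun x => (hAjR (q + 1) (π x)).symm⟩

end Factorization

theorem coe_pow_range {X : Type*} [NormedAddCommGroup X] [NormedSpace ℂ X] (A : X →L[ℂ] X)
    (q : ℕ) : LinearMap.range ((A : Module.End ℂ X) ^ q) = (A ^ q).range := by
  rw [← ContinuousLinearMap.toLinearMap_pow]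

end DescentSpectrum

open DescentSpectrum in
theorem theorem3 {X : Type*} [NormedAddCommGroup X] [NormedSpace ℂ X] [CompleteSpace X]
    (T : X →L[ℂ] X)
    (hT : ∀ z ∈ DescentSpectrum.surjectivityResolventSet T,
      (connectedComponentIn (DescentSpectrum.surjectivityResolventSet T) z ∩
        (DescentSpectrum.pointSpectrum T)ᶜ).Nonempty) :
    DescentSpectrum.descentSpectrum T =
      DescentSpectrum.elementDescentSpectrum (A := X →L[ℂ] X) T := by
  have hinj : ∀ z ∈ surjectivityResolventSet T, z ∉ pointSpectrum T := fun z hz =>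
    notMem_pointSpectrum_of_isPreconnected isPreconnected_connectedComponentIn
      (connectedComponentIn_subset _ _) (hT z hz) (mem_connectedComponentIn hz)
  ext z
  set A : X →L[ℂ] X := T - algebraMap ℂ (X →L[ℂ] X) z with hA
  have hAz : ∀ x, A x = T x - z • x := fun x => rfl
  have hneg : z • ContinuousLinearMap.id ℂ X - T = -A := (neg_sub _ _).symm
  have hmem : z ∈ descentSpectrum T ↔ descent (A : Module.End ℂ X) = ⊤ := by
    rw [← descent_neg, ← ContinuousLinearMap.toLinearMap_neg, ← hneg]
    rfl
  have hmem' : z ∈ elementDescentSpectrum (A := X →L[ℂ] X) T ↔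
      descent (LinearMap.mulLeft ℂ A) = ⊤ := Iff.rfl
  rw [hmem, hmem', descent_eq_top_iff, descent_eq_top_iff]
  simp only [coe_pow_range]
  -- The two range conditions are equivalent at each single `q`.
  refine forall_congr' fun q => not_congr ?_
  rw [range_mulLeft_pow_eq_iff]
  constructor
  · intro h
    refine exists_pow_eq_pow_succ_mul A (fun μ hμ x hx => ?_) q fun x => ?_
    · by_contra hx0
      refine hinj (z + μ) ?_ (mem_pointSpectrum.2 ⟨x, hx0, ?_⟩)
      · rw [mem_surjectivityResolventSet]
        intro y
        obtain ⟨w, hw⟩ := hμ (-y)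
        refine ⟨w, ?_⟩
        calc ((z + μ) • ContinuousLinearMap.id ℂ X - T) w = -(T w - z • w - μ • w) := by
              rw [sub_apply, smul_apply, ContinuousLinearMap.id_apply, add_smul]
              abel
          _ = y := neg_eq_iff_eq_neg.2 hw
      · rw [hAz, sub_eq_iff_eq_add] at hx
        rw [hx, add_smul, add_comm]
    · have : (A ^ q) x ∈ (A ^ (q + 1)).range := h ▸ ⟨x, rfl⟩
      obtain ⟨w, hw⟩ := this
      exact ⟨w, hw.symm⟩
  · rintro ⟨B, hB⟩
    apply le_antisymm
    · rintro _ ⟨x, rfl⟩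
      exact ⟨B x, (DFunLike.congr_fun hB x).symm⟩
    · rintro _ ⟨x, rfl⟩
      exact ⟨A x, by simp [pow_succ]⟩
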